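/- Let $d\in\{2,3\}$, let $\Omega\subset\mathbb R^d$ be a bounded Lipschitz open set with $\partial\Omega=\Gamma_a\cup\Gamma_b$ ($\Gamma_a,\Gamma_b$ measurable), and let the Lamé coefficients $\lambda,\mu$ be bounded and measurable with $\mu\ge c$ and $2\mu+d\lambda\ge c$ a.e. in $\Omega$ for some $c>0$. Put $\varepsilon(v)=\frac12(\nabla v+\nabla v^T)$, $\sigma(v)=2\mu\,\varepsilon(v)+\lambda(\nabla\cdot v)I$, $a(v,w)=\int_\Omega\sigma(v):\varepsilon(w)\,dx$ and $\|v\|_a=a(v,v)^{1/2}$. For open $U\subseteq\Omega$ let $H^1_a(U)$ be the space of $v\in H^1(U)^d$ with $v=0$ on $\Gamma_a\cap\partial U$. Let $f\in L^2(\Omega)^d$, $g\in L^2(\Gamma_b)^d$, $h\in H^1(\Omega)^d$, and let $u\in h+H^1_a(\Omega)$ be the weak solution of the elasticity problem with body force $f$, $u=h$ on $\Gamma_a$ and $\sigma(u)n=g$ on $\Gamma_b$, i.e. $$\int_\Omega\sigma(u-h):\nabla v\,dx=\int_\Omega f\cdot v\,dx+\int_{\Gamma_b}g\cdot v\,ds-\int_\Omega\sigma(h):\nabla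 v\,dx\qquad\forall v\in H^1_a(\Omega).$$ Let $K_1,\dots,K_N$ be a coarse grid: nonempty, pairwise disjoint Lipschitz open sets $K_j\subseteq\Omega$ whose closures cover $\overline\Omega$, with $|\Omega\setminus\bigcup_jK_j|=0$ and such that $\partial K_i\cap\partial K_j\cap\partial\Omega$ has zero surface measure for $i\ne j$ (for instance a quadrilateral or hexahedral mesh). Let $(\chi_i)$ be a finite partition of unity on $\Omega$ by Lipschitz functions, $\tilde\kappa=\sum_i(\lambda+2\mu)\nabla\chi_i\cdot\nabla\chi_i$, and assume that $\tilde\kappa$ is bounded below by a positive constant a.e. in $\Omega$. Put $s(v,w)=\sum_j s_j(v,w)$ with $s_j(v,w)=\int_{K_j}\tilde\kappa\,v\cdot w\,dx$. On each $K_j$ let $V(K_j)$ be a linear space with $H^1_a(K_j)\subseteq V(K_j)\subseteq H^1(K_j)^d$, and let $(\theta_j^i,\phi_j^i)_{i\ge0}$ be the complete $s_j$-orthogonal system of eigenpairs of $$\int_{K_j}\sigma(\phi):\varepsilon(v)\,dx=\theta\,s_j(\phi,v)\quad\forall v\in V(K_j),\qquad \theta_j^0\le\theta_j^1\le\theta_j^2\le\cdots.$$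 Given integers $g_j\ge0$, let $V_{\rm aux}=\bigoplus_jV_{\rm aux}(K_j)$, $V_{\rm aux}(K_j)=\operatorname{span}\{\phi_j^i: 0\le i<g_j\}$ (elements extended by zero outside $K_j$), so that $\theta_j^{g_j}$ is the first excluded eigenvalue on $K_j$, and let $\Lambda=\min_j\theta_j^{g_j}$; assume $\Lambda>0$. For $0\le i<g_j$ let $\xi_j^i$ minimize $a(\xi,\xi)$ among all $\xi\in H^1_a(\Omega)$ with $s(\xi-\phi_j^i,z)=0$ for all $z\in V_{\rm aux}$, and let $V_{\rm glo}$ be the span of all the $\xi_j^i$. Let $\mathcal H_{\rm glo}h=\sum_j\mathcal H^j_{\rm glo}h$ and $\mathcal G_{\rm glo}g=\sum_j\mathcal G^j_{\rm glo}g$, where $R=\mathcal H^j_{\rm glo}h$ (with $\ell_j(v)=\int_{K_j}\sigma(h):\varepsilon(v)\,dx$) and $R=\mathcal G^j_{\rm glo}g$ (with $\ell_j(v)=\int_{\partial K_j\cap\Gamma_b}g\cdot v\,ds$) are in $H^1_a(\Omega)$ and satisfy, with some $\vartheta\in V_{\rm aux}$, $$a(R,z_1)+s(z_1,\vartheta)=\ell_j(z_1)\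 \ \forall z_1\in H^1_a(\Omega),\qquad s(R,z_2)=\ell_j(z_2|_{K_j})\ \ \forall z_2\in V_{\rm aux}.$$ Let $l_{\rm glo}\in V_{\rm glo}$ satisfy, for all $v\in V_{\rm glo}$, $$a(l_{\rm glo},v)=\int_\Omega f\cdot v\,dx+\int_{\Gamma_b}g\cdot v\,ds-\int_\Omega\sigma(h):\nabla v\,dx+a(\mathcal H_{\rm glo}h,v)-a(\mathcal G_{\rm glo}g,v),$$ and put $u_{\rm glo}=l_{\rm glo}-\mathcal H_{\rm glo}h+\mathcal G_{\rm glo}g+h$. Then $$\|u_{\rm glo}-u\|_a\le\Lambda^{-1/2}\,\|\tilde\kappa^{-1/2}f\|_{L^2(\Omega)},$$ and, if $\tilde\kappa\ge1$ a.e. in $\Omega$, $$\|u_{\rm glo}-u\|_a\le\Lambda^{-1/2}\,\|f\|_{L^2(\Omega)}.$$ -/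

import Mathlib

open MeasureTheory Filter Topology
open scoped ContDiff BigOperators

noncomputable section

namespace CEM

/-- Physical space `ℝᵈ`. -/
abbrev Pt (d : ℕ) : Type := EuclideanSpace ℝ (Fin d)

/-- Lebesgue measure restricted to `U`. -/
abbrev vol {d : ℕ} (U : Set (Pt d)) : Measure (Pt d) := (volume : Measure (Pt d)).restrict U

/-- Surface measure (the normalised `(d-1)`-dimensional Hausdorff measure) restricted to `S`. -/
abbrev surf {d : ℕ} (S : Set (Pt d)) : Measure (Pt d) :=
  (Measure.euclideanHausdorffMeasure (d - 1) : Measure (Pt d)).restrict S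

/-- A bounded open set that is locally, near each boundary point and in suitable orthonormal
coordinates, the region above the graph of a Lipschitz function: `ν` is the vertical direction and
`ψ` depends only on the coordinates orthogonal to `ν`. -/
def IsLipschitzDomain {d : ℕ} (U : Set (Pt d)) : Prop :=
  IsOpen U ∧ Bornology.IsBounded U ∧
    ∀ x ∈ frontier U, ∃ (ν : Pt d) (r : ℝ) (L : NNReal) (ψ : Pt d → ℝ),
      ‖ν‖ = 1 ∧ 0 < r ∧ LipschitzWith L ψ ∧ (∀ (y : Pt d) (t : ℝ), ψ (y + t • ν) = ψ y) ∧
        U ∩ Metric.ball x r = {y ∈ Metric.ball x r | ψ y < inner ℝ ν y}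

/-! ### Vector-valued Sobolev functions -/

/-- A triple of functions that will represent a vector-valued `H¹` function: the function itself,
its weak gradient (`grad x i k = ∂ₖ vᵢ (x)`) and its boundary trace. -/
abbrev VF (d : ℕ) : Type := (Pt d → Pt d) × (Pt d → Fin d → Fin d → ℝ) × (Pt d → Pt d)

/-- The function. -/
abbrev VF.val {d : ℕ} (v : VF d) : Pt d → Pt d := v.1

/-- Its weak gradient. -/
abbrev VF.grad {d : ℕ} (v : VF d) : Pt d → Fin d → Fin d → ℝ := v.2.1

/-- Its boundary trace. -/
abbrev VF.tr {d : ℕ} (v : VF d) : Pt d → Pt d := v.2.2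

/-- The `k`-th standard basis vector. -/
abbrev e {d : ℕ} (k : Fin d) : Pt d := EuclideanSpace.single k 1

/-- The triple represented by a smooth vector field on `ℝᵈ`. -/
def ofSmooth {d : ℕ} (w : Pt d → Pt d) : VF d :=
  (w, fun x i k => fderiv ℝ w x (e k) i, w)

/-- `G` is the weak gradient of `v` in `U`. -/
def IsWeakGrad {d : ℕ} (U : Set (Pt d)) (v : Pt d → Pt d) (G : Pt d → Fin d → Fin d → ℝ) : Prop :=
  ∀ ζ : Pt d → ℝ, ContDiff ℝ ∞ ζ → HasCompactSupport ζ → tsupport ζ ⊆ U →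
    ∀ i k : Fin d, ∫ x in U, v x i * fderiv ℝ ζ x (e k) = -∫ x in U, G x i k * ζ x

/-- `v.tr` is the trace of `v` on the part `S` of the boundary of `U`: there are smooth vector
fields that converge to `v` in `H¹(U)` and whose restrictions to `S` converge to `v.tr` in
`L²(S)`. -/
def IsTraceOn {d : ℕ} (U S : Set (Pt d)) (v : VF d) : Prop :=
  ∃ w : ℕ → Pt d → Pt d, (∀ n, ContDiff ℝ ∞ (w n)) ∧
    Tendsto (fun n => eLpNorm (w n - v.val) 2 (vol U)) atTop (𝓝 0) ∧
    (∀ i k, Tendsto (fun n =>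
      eLpNorm (fun x => (ofSmooth (w n)).grad x i k - v.grad x i k) 2 (vol U)) atTop (𝓝 0)) ∧
    Tendsto (fun n => eLpNorm (w n - v.tr) 2 (surf S)) atTop (𝓝 0)

/-- `H¹(U)` for an open `U ⊆ Ω`: an `L²` function with an `L²` weak gradient on `U`, recorded
together with its trace on the part `∂U ∩ ∂Ω` of the boundary. For `U = Ω` the trace is recorded on
the whole of `∂Ω`. On Lipschitz domains weak gradient and trace exist and are determined by the
function up to null sets. -/
def IsH1 {d : ℕ} (Ω U : Set (Pt d)) (v : VF d) : Prop :=
  MemLp v.val 2 (vol U) ∧ (∀ i k, MemLp (fun x => v.grad x i k) 2 (vol U)) ∧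
    MemLp v.tr 2 (surf (frontier U ∩ frontier Ω)) ∧
    IsWeakGrad U v.val v.grad ∧ IsTraceOn U (frontier U ∩ frontier Ω) v

/-- `H¹_a(U)`: the functions in `H¹(U)` that vanish on `Γ_a ∩ ∂U` (where `Γ_a ⊆ ∂Ω`). -/
def IsH1a {d : ℕ} (Ω Γa U : Set (Pt d)) (v : VF d) : Prop :=
  IsH1 Ω U v ∧ ∀ᵐ x ∂(surf (frontier U ∩ Γa)), v.tr x = 0

/-! ### Elasticity -/

/-- Strain `ε(v) = (∇v + ∇vᵀ) / 2`. -/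
def strain {d : ℕ} (v : VF d) (x : Pt d) (i k : Fin d) : ℝ :=
  (v.grad x i k + v.grad x k i) / 2

/-- Divergence. -/
def div {d : ℕ} (v : VF d) (x : Pt d) : ℝ := ∑ l, v.grad x l l

/-- Stress `σ(v) = 2 μ ε(v) + λ (∇ · v) I`. -/
def stress {d : ℕ} (lam mu : Pt d → ℝ) (v : VF d) (x : Pt d) (i k : Fin d) : ℝ :=
  2 * mu x * strain v x i k + if i = k then lam x * div v x else 0

/-- `a(v, w) = ∫_U σ(v) : ε(w) dx`. -/
def aForm {d : ℕ} (lam mu : Pt d → ℝ) (U : Set (Pt d)) (v w : VF d) : ℝ :=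
  ∫ x in U, ∑ i, ∑ k, stress lam mu v x i k * strain w x i k

/-- `∫_U σ(v) : grad(w) dx`. -/
def stressGrad {d : ℕ} (lam mu : Pt d → ℝ) (U : Set (Pt d)) (v w : VF d) : ℝ :=
  ∫ x in U, ∑ i, ∑ k, stress lam mu v x i k * w.grad x i k

/-- The energy norm `‖v‖_a = a(v, v)^{1/2}` on `U`. -/
def aNorm {d : ℕ} (lam mu : Pt d → ℝ) (U : Set (Pt d)) (v : VF d) : ℝ :=
  Real.sqrt (aForm lam mu U v v)

/-- Bounded measurable Lamé coefficients whose elasticity tensor is uniformly positive definite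
on `Ω`. -/
structure IsLame {d : ℕ} (Ω : Set (Pt d)) (lam mu : Pt d → ℝ) : Prop where
  meas_lam : AEStronglyMeasurable lam (vol Ω)
  meas_mu : AEStronglyMeasurable mu (vol Ω)
  bounds : ∃ c C : ℝ, 0 < c ∧ ∀ᵐ x ∂(vol Ω),
    c ≤ mu x ∧ c ≤ 2 * mu x + d * lam x ∧ mu x ≤ C ∧ |lam x| ≤ C

/-- `ut` is the weak solution of the problem with homogeneous Dirichlet data on `Γ_a`, that is,
`u = ut + h` is the solution of the elasticity problem with body force `f`, displacement `h` on
`Γ_a` and traction `g` on `Γ_b`. -/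
structure IsWeakSolution {d : ℕ} (Ω Γa Γb : Set (Pt d)) (lam mu : Pt d → ℝ)
    (f g : Pt d → Pt d) (h ut : VF d) : Prop where
  mem : IsH1a Ω Γa Ω ut
  eq : ∀ v, IsH1a Ω Γa Ω v →
    stressGrad lam mu Ω ut v =
      (∫ x in Ω, inner ℝ (f x) (v.val x)) + (∫ x, inner ℝ (g x) (v.tr x) ∂(surf Γb))
        - stressGrad lam mu Ω h v

/-! ### Coarse grid, weight and auxiliary space -/

/-- A coarse grid of `Ω` with finitely many blocks `K j`. The last condition says that the part of
`∂Ω` lying on two blocks has no surface area. -/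
structure IsCoarseGrid {d : ℕ} {ι : Type*} (Ω : Set (Pt d)) (K : ι → Set (Pt d)) : Prop where
  nonempty : ∀ j, (K j).Nonempty
  lipschitz : ∀ j, IsLipschitzDomain (K j)
  subset : ∀ j, K j ⊆ Ω
  disjoint : ∀ j j', j ≠ j' → Disjoint (K j) (K j')
  cover : closure Ω = ⋃ j, closure (K j)
  null : volume (Ω \ ⋃ j, K j) = 0
  boundary_null : ∀ j j', j ≠ j' →
    (Measure.euclideanHausdorffMeasure (d - 1) : Measure (Pt d))
      (frontier (K j) ∩ frontier (K j') ∩ frontier Ω) = 0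

/-- A finite partition of unity on `Ω` by Lipschitz functions. -/
structure IsPartitionOfUnity {d : ℕ} {τ : Type*} [Fintype τ] (Ω : Set (Pt d))
    (χ : τ → Pt d → ℝ) : Prop where
  lipschitz : ∀ i, ∃ L : NNReal, LipschitzOnWith L (χ i) Ω
  nonneg : ∀ i, ∀ x ∈ Ω, 0 ≤ χ i x
  sum_eq_one : ∀ x ∈ Ω, ∑ i, χ i x = 1

/-- The weight `κ̃ = ∑ᵢ (λ + 2μ) ∇χᵢ · ∇χᵢ`. -/
def kappa {d : ℕ} {τ : Type*} [Fintype τ] (lam mu : Pt d → ℝ) (χ : τ → Pt d → ℝ) (x : Pt d) : ℝ :=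
  ∑ i, (lam x + 2 * mu x) * inner ℝ (gradient (χ i) x) (gradient (χ i) x)

/-- `∫_U κ̃ v · w dx`. -/
def sBlock {d : ℕ} (κ : Pt d → ℝ) (U : Set (Pt d)) (v w : VF d) : ℝ :=
  ∫ x in U, κ x * inner ℝ (v.val x) (w.val x)

/-- The form `s` on block-wise given functions `z = (z j)_j`: the sum of the block contributions. -/
def sForm {d : ℕ} {ι : Type*} [Fintype ι] (κ : Pt d → ℝ) (K : ι → Set (Pt d))
    (z z' : ι → VF d) : ℝ :=
  ∑ j, sBlock κ (K j) (z j) (z' j)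

/-- A function on `Ω` as a block-wise given function. -/
def toBlocks {d : ℕ} (ι : Type*) (v : VF d) : ι → VF d := fun _ => v

/-- The eigenpairs `(θ i, φ i)`, `i = 0, 1, 2, …`, of the spectral problem
`a(φ, v) = θ s(φ, v)` for all `v ∈ V`, on a block `U`: eigenvalues in nondecreasing order
(repeated according to multiplicity), with a complete `s`-orthogonal system of eigenfunctions. -/
structure IsEigenSystem {d : ℕ} (lam mu κ : Pt d → ℝ) (U : Set (Pt d))
    (V : Submodule ℝ (VF d)) (θ : ℕ → ℝ) (φ : ℕ → VF d) : Prop where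
  mem : ∀ i, φ i ∈ V
  eigen : ∀ i, ∀ v ∈ V, aForm lam mu U (φ i) v = θ i * sBlock κ U (φ i) v
  mono : Monotone θ
  ne_zero : ∀ i, 0 < sBlock κ U (φ i) (φ i)
  orth : ∀ i i', i ≠ i' → sBlock κ U (φ i) (φ i') = 0
  complete : ∀ v ∈ V, ∀ δ > 0, ∃ w ∈ Submodule.span ℝ (Set.range φ),
    sBlock κ U (v - w) (v - w) < δ

/-- The auxiliary space `V_aux = ⨁ⱼ V_aux(K j)`, where `V_aux(K j)` is the span of the first `g j`
eigenfunctions on `K j`. -/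
def auxSpace {d : ℕ} {ι : Type*} (φ : ι → ℕ → VF d) (g : ι → ℕ) : Submodule ℝ (ι → VF d) :=
  Submodule.pi Set.univ fun j => Submodule.span ℝ (φ j '' Set.Iio (g j))

/-! ### Global multiscale objects -/

/-- `ξ` satisfies the constraint belonging to `q ∈ V_aux`: `s(ξ - q, z) = 0` for all `z ∈ V_aux`,
i.e. the `s`-projection of `ξ` onto `V_aux` is `q`. -/
def SatisfiesConstraint {d : ℕ} {ι : Type*} [Fintype ι] (κ : Pt d → ℝ) (K : ι → Set (Pt d))
    (Vaux : Submodule ℝ (ι → VF d)) (q : ι → VF d) (ξ : VF d) : Prop :=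
  ∀ z ∈ Vaux, sForm κ K (toBlocks ι ξ - q) z = 0

/-- Global constrained basis function belonging to `q ∈ V_aux`: a minimiser of the energy among all
`ξ ∈ H¹_a(Ω)` that satisfy the constraint. -/
structure IsGlobalBasis {d : ℕ} {ι : Type*} [Fintype ι] (Ω Γa : Set (Pt d))
    (lam mu κ : Pt d → ℝ) (K : ι → Set (Pt d)) (Vaux : Submodule ℝ (ι → VF d))
    (q : ι → VF d) (ξ : VF d) : Prop where
  mem : IsH1a Ω Γa Ω ξ
  constraint : SatisfiesConstraint κ K Vaux q ξ
  minimal : ∀ η, IsH1a Ω Γa Ω η → SatisfiesConstraint κ K Vaux q η →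
    aForm lam mu Ω ξ ξ ≤ aForm lam mu Ω η η

/-- `V_glo`, the span of the basis functions `ξ j i` with `i < g j`. -/
def gloSpace {d : ℕ} {ι : Type*} (ξ : ι → ℕ → VF d) (g : ι → ℕ) : Submodule ℝ (VF d) :=
  Submodule.span ℝ {v | ∃ j, ∃ i < g j, v = ξ j i}

/-- Global constrained corrector for a load `ℓ` living on the block `K j`: there is a multiplier
`ϑ ∈ V_aux` such that `a(R, z₁) + s(z₁, ϑ) = ℓ(z₁)` for all `z₁ ∈ H¹_a(Ω)` and `s(R, z₂) = ℓ(z₂)`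
for all `z₂ ∈ V_aux`. -/
structure IsGlobalCorrector {d : ℕ} {ι : Type*} [Fintype ι] (Ω Γa : Set (Pt d))
    (lam mu κ : Pt d → ℝ) (K : ι → Set (Pt d)) (Vaux : Submodule ℝ (ι → VF d))
    (ℓ : VF d → ℝ) (j : ι) (R : VF d) : Prop where
  mem : IsH1a Ω Γa Ω R
  eq_energy : ∃ ϑ ∈ Vaux, ∀ z₁, IsH1a Ω Γa Ω z₁ →
    aForm lam mu Ω R z₁ + sForm κ K (toBlocks ι z₁) ϑ = ℓ z₁
  eq_constraint : ∀ z₂ ∈ Vaux, sForm κ K (toBlocks ι R) z₂ = ℓ (z₂ j)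

/-- The load `∫_{K_j} σ(h) : ε(v) dx` of the Dirichlet corrector is `aForm lam mu (K j) h v`; this
is the load `∫_{∂K_j ∩ Γ_b} g · v ds` of the Neumann corrector. -/
def neumannLoad {d : ℕ} (Γb : Set (Pt d)) (g : Pt d → Pt d) (U : Set (Pt d)) (v : VF d) : ℝ :=
  ∫ x, inner ℝ (g x) (v.tr x) ∂(surf (frontier U ∩ Γb))

/-- `l ∈ V_glo` solves the global multiscale Galerkin problem, given the correctors `Hh` and
`Gg`. -/
structure IsGlobalGalerkin {d : ℕ} (Ω Γb : Set (Pt d)) (lam mu : Pt d → ℝ)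
    (f g : Pt d → Pt d) (h : VF d) (Vglo : Submodule ℝ (VF d)) (Hh Gg l : VF d) : Prop where
  mem : l ∈ Vglo
  eq : ∀ v ∈ Vglo,
    aForm lam mu Ω l v =
      (∫ x in Ω, inner ℝ (f x) (v.val x)) + (∫ x, inner ℝ (g x) (v.tr x) ∂(surf Γb))
        - stressGrad lam mu Ω h v + aForm lam mu Ω Hh v - aForm lam mu Ω Gg v

end CEM

end

/-!
The proof is purely variational and takes place in `H¹_a(Ω)` with the energy form `a`, which is
symmetric and positive semidefinite.

Let `e = u_glo - u = l - H + G - (u - h)`, where `H` and `G` are the sums of the Dirichlet and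
Neumann correctors. The Galerkin equation makes `e` energy-orthogonal to
`V_glo`. By minimality, each basis function is energy-orthogonal to every `w ∈ H¹_a(Ω)` whose
`s`-moments against the selected eigenfunctions vanish (`IsGlobalBasis.orthogonal`). As the basis
functions are dual to these moments, `e = w + v` with such a `w` and with `v ∈ V_glo`; both
orthogonalities together give `a(v, v) = 0` and `a(e, e) = a(w, w) = a(e, w)`
(`exists_zero_moments`). It does not matter that `v` may be nonzero, so neither a Korn inequality
nor a condition on the size of `Γ_a` enters.

In `a(e, w)` the multipliers of the correctors drop out, and the correctors cancel the boundary data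
(`aForm_sum_corrector`, `IsCoarseGrid.sum_neumannLoad`); what remains is
`a(w, w) = -∫ f · w`. On every block, `w` is `s`-orthogonal to the selected eigenfunctions, so that
`Λ s(w, w) ≤ a(w, w)` (`spectral_gap`, `IsEigenSystem.le_rayleigh`). Young's inequality now yields
`a(e, e) ≤ Λ⁻¹ ∫ κ̃⁻¹ |f|²` (`energy_le_of_load`).
-/

open MeasureTheory Filter Topology
open scoped ContDiff BigOperators

noncomputable section

namespace CEM

/-! ### Two facts about pairs of bilinear forms -/

section Abstract

variable {X : Type*} [AddCommGroup X] [Module ℝ X]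

/-- Abstract spectral gap: in a complete `s`-orthogonal system of eigenvectors of `a` relative to
`s`, a vector orthogonal to the first `n` eigenvectors has Rayleigh quotient at least `θ n`.
Completeness is only required in the seminorm of `s`: Parseval's identity for `s` is combined with
Bessel's inequality for `a`. -/
theorem spectral_gap (a s : LinearMap.BilinForm ℝ X)
    (ha : ∀ x y, a x y = a y x) (ha0 : ∀ x, 0 ≤ a x x)
    (hs : ∀ x y, s x y = s y x) (hs0 : ∀ x, 0 ≤ s x x)
    (θ : ℕ → ℝ) (φ : ℕ → X) (heig : ∀ i v, a (φ i) v = θ i * s (φ i) v) (hmono : Monotone θ)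
    (hpos : ∀ i, 0 < s (φ i) (φ i)) (horth : ∀ i i', i ≠ i' → s (φ i) (φ i') = 0)
    (hcomp : ∀ v, ∀ δ > 0, ∃ (T : Finset ℕ) (b : ℕ → ℝ),
      s (v - ∑ i ∈ T, b i • φ i) (v - ∑ i ∈ T, b i • φ i) < δ)
    (n : ℕ) (w : X) (hw : ∀ i < n, s w (φ i) = 0) :
    θ n * s w w ≤ a w w := by
  have hθ : 0 ≤ θ n := by
    have h1 := ha0 (φ n)
    rw [heig] at h1
    exact nonneg_of_mul_nonneg_left h1 (hpos n)
  refine le_of_forall_pos_le_add fun η hη => ?_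
  obtain ⟨T, b, hT⟩ := hcomp w (η / (θ n + 1)) (by positivity)
  set c : ℕ → ℝ := fun i => s w (φ i) / s (φ i) (φ i)
  have hcs : ∀ i, c i * s (φ i) (φ i) = s w (φ i) := fun i =>
    div_mul_cancel₀ _ (hpos i).ne'
  -- `P` is the `s`-orthogonal projection of `w` onto the span of the `φ i` with `i ∈ T`.
  set P : X := ∑ i ∈ T, c i • φ i with hP
  have hsP : ∀ i ∈ T, s (φ i) P = s w (φ i) := by
    intro i hi
    rw [hP, map_sum, Finset.sum_eq_single i]
    · rw [map_smul, smul_eq_mul, hcs]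
    · intro k _ hk
      rw [map_smul, horth i k hk.symm, smul_zero]
    · exact fun h => absurd hi h
  have hdiff : ∀ y, s P y = ∑ i ∈ T, c i * s (φ i) y := by
    intro y
    simp [hP, map_sum, LinearMap.sum_apply]
  have hperp : ∀ q : ℕ → ℝ, s (w - P) (∑ i ∈ T, q i • φ i) = 0 := by
    intro q
    rw [map_sum]
    refine Finset.sum_eq_zero fun i hi => ?_
    rw [map_smul, map_sub, LinearMap.sub_apply, hs P, hsP i hi, sub_self, smul_zero]
  set Ps : ℝ := ∑ i ∈ T, c i * s w (φ i) with hPs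
  have hwP : s w P = Ps := by simp [hP, hPs, map_sum]
  have hPP : s P P = Ps := by
    rw [hdiff, hPs]
    exact Finset.sum_congr rfl fun i hi => by rw [hsP i hi]
  have hpars : s w w - Ps < η / (θ n + 1) := by
    refine lt_of_le_of_lt ?_ hT
    set y : X := ∑ i ∈ T, b i • φ i with hy
    have h1 : P - y = ∑ i ∈ T, (c i - b i) • φ i := by
      simp [hP, hy, sub_smul, Finset.sum_sub_distrib]
    have h2 : s (w - P) (P - y) = 0 := by rw [h1]; exact hperp _
    have h3 : w - y = (w - P) + (P - y) := by abel
    have h4 := hs0 (P - y)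
    have h5 : s (w - P) (w - P) = s w w - Ps := by
      simp only [map_sub, LinearMap.sub_apply, hwP, hPP, hs P w]; ring
    have h6 : s (w - y) (w - y) = s (w - P) (w - P) + s (P - y) (P - y) := by
      rw [h3, map_add, map_add, LinearMap.add_apply, LinearMap.add_apply, hs (P - y) (w - P), h2]
      ring
    rw [h6, h5]
    linarith
  have hbessel : ∑ i ∈ T, θ i * (c i * s w (φ i)) ≤ a w w := by
    have h1 : a w P = ∑ i ∈ T, θ i * (c i * s w (φ i)) := by
      rw [hP, map_sum]
      refine Finset.sum_congr rfl fun i _ => ?_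
      rw [map_smul, ha, heig, hs, smul_eq_mul]; ring
    have h2 : a P P = ∑ i ∈ T, θ i * (c i * s w (φ i)) := by
      have h : ∀ y, a P y = ∑ i ∈ T, c i * a (φ i) y := fun y => by
        simp [hP, map_sum, LinearMap.sum_apply]
      rw [h]
      refine Finset.sum_congr rfl fun i hi => ?_
      rw [heig, hsP i hi]; ring
    have h3 := ha0 (w - P)
    simp only [map_sub, LinearMap.sub_apply, ha P w, h1, h2] at h3
    linarith
  have hle : θ n * Ps ≤ ∑ i ∈ T, θ i * (c i * s w (φ i)) := by
    rw [hPs, Finset.mul_sum]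
    refine Finset.sum_le_sum fun i _ => ?_
    rcases lt_or_ge i n with hi | hi
    · simp [hw i hi]
    · refine mul_le_mul_of_nonneg_right (hmono hi) ?_
      rw [← hcs i, ← mul_assoc]
      exact mul_nonneg (mul_self_nonneg _) (hpos i).le
  have hη' : θ n * (η / (θ n + 1)) ≤ η := by
    rw [mul_div_assoc', div_le_iff₀ (by positivity)]
    nlinarith
  nlinarith [mul_le_mul_of_nonneg_left hpars.le hθ]

/-- If vectors `ξ k` are dual (up to nonzero factors `m k`) to functionals `p k` and `a`-orthogonal
to `⋂ k, ker (p k)`, then a vector `e` that is `a`-orthogonal to all `ξ k` differs from an element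
`w` of the common kernel by a vector of zero energy. -/
theorem exists_mem_ker_of_orthogonal {κ : Type*} [Fintype κ] [DecidableEq κ]
    (a : LinearMap.BilinForm ℝ X) (p : κ → X →ₗ[ℝ] ℝ) (ξ : κ → X) (m : κ → ℝ) (hm : ∀ k, m k ≠ 0)
    (hp : ∀ k k', p k' (ξ k) = if k = k' then m k else 0)
    (hξ : ∀ k w, (∀ k', p k' w = 0) → a (ξ k) w = 0)
    (e : X) (he : ∀ k, a e (ξ k) = 0) :
    ∃ w, (∀ k, p k w = 0) ∧ a e e = a w w ∧ a e e = a e w := by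
  set v : X := ∑ k, (p k e / m k) • ξ k with hv
  have hker : ∀ k, p k (e - v) = 0 := by
    intro k
    simp [hv, map_sum, hp, hm]
  have hev : a e v = 0 := by simp [hv, map_sum, he]
  have hvw : a v (e - v) = 0 := by
    rw [hv, map_sum, LinearMap.sum_apply]
    refine Finset.sum_eq_zero fun k _ => ?_
    rw [map_smul, LinearMap.smul_apply, ← hv, hξ k _ hker, smul_zero]
  refine ⟨e - v, hker, ?_, ?_⟩
  · rw [map_sub a, LinearMap.sub_apply, hvw, map_sub, hev]; ring
  · rw [map_sub, hev, sub_zero]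

/-- First-order optimality: a minimiser of the energy in the direction of a line through it is
orthogonal to that line. -/
theorem orthogonal_of_minimal (a : LinearMap.BilinForm ℝ X) (ha : ∀ x y, a x y = a y x) (x w : X)
    (hmin : ∀ t : ℝ, a x x ≤ a (x + t • w) (x + t • w)) : a x w = 0 := by
  have key : ∀ t : ℝ, 0 ≤ a w w * (t * t) + 2 * a x w * t + 0 := by
    intro t
    have h1 := hmin t
    simp only [map_add, map_smul, LinearMap.add_apply, LinearMap.smul_apply, smul_eq_mul,
      ha w x] at h1
    nlinarith
  have h2 := discrim_le_zero key
  rw [discrim] at h2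
  nlinarith [sq_nonneg (a x w)]

end Abstract

/-! ### Square integrable fields and the spaces `H¹` -/

variable {d : ℕ}

theorem integrable_inner {μ : Measure (Pt d)} {f g : Pt d → Pt d}
    (hf : MemLp f 2 μ) (hg : MemLp g 2 μ) : Integrable (fun x => inner ℝ (f x) (g x)) μ :=
  (MemLp.integrable_mul hf.norm hg.norm).mono' (hf.1.inner hg.1)
    (Eventually.of_forall fun _ => norm_inner_le_norm _ _)

theorem integrable_bdd_mul {μ : Measure (Pt d)} {κ F : Pt d → ℝ}
    (hκ : MemLp κ ⊤ μ) (hF : Integrable F μ) : Integrable (fun x => κ x * F x) μ := by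
  exact memLp_one_iff_integrable.1 (MemLp.mul' (memLp_one_iff_integrable.2 hF) hκ)

theorem tendsto_eLpNorm_add {E : Type*} [NormedAddCommGroup E] {μ : Measure (Pt d)}
    {F G : ℕ → Pt d → E} (hF : ∀ n, AEStronglyMeasurable (F n) μ)
    (hG : ∀ n, AEStronglyMeasurable (G n) μ)
    (hF0 : Tendsto (fun n => eLpNorm (F n) 2 μ) atTop (𝓝 0))
    (hG0 : Tendsto (fun n => eLpNorm (G n) 2 μ) atTop (𝓝 0)) :
    Tendsto (fun n => eLpNorm (F n + G n) 2 μ) atTop (𝓝 0) :=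
  tendsto_of_tendsto_of_tendsto_of_le_of_le tendsto_const_nhds
    (by simpa using hF0.add hG0) (fun _ => zero_le)
    (fun n => eLpNorm_add_le (hF n) (hG n) (by norm_num))

theorem tendsto_eLpNorm_const_smul {E : Type*} [NormedAddCommGroup E] [NormedSpace ℝ E]
    {μ : Measure (Pt d)} {F : ℕ → Pt d → E} (c : ℝ)
    (hF0 : Tendsto (fun n => eLpNorm (F n) 2 μ) atTop (𝓝 0)) :
    Tendsto (fun n => eLpNorm (c • F n) 2 μ) atTop (𝓝 0) := by
  simp_rw [eLpNorm_const_smul]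
  simpa using ENNReal.Tendsto.const_mul hF0 (Or.inr (by simp : ‖c‖ₑ ≠ ⊤))

theorem continuous_ofSmooth_grad {w : Pt d → Pt d} (hw : ContDiff ℝ ∞ w) (i k : Fin d) :
    Continuous (fun x => (ofSmooth w).grad x i k) := by
  have h1 : Continuous (fun x => fderiv ℝ w x (e k)) :=
    (hw.continuous_fderiv (by simp)).clm_apply continuous_const
  exact (EuclideanSpace.proj (𝕜 := ℝ) i).continuous.comp h1

/-- The triples whose function and gradient are square integrable on `U`. Nothing is required of
the gradient component beyond integrability, which is all the bilinear forms depend on. -/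
def L2Fields (U : Set (Pt d)) : Submodule ℝ (VF d) where
  carrier := {v | MemLp v.val 2 (vol U) ∧ ∀ i k, MemLp (fun x => v.grad x i k) 2 (vol U)}
  add_mem' hv hw := ⟨hv.1.add hw.1, fun i k => (hv.2 i k).add (hw.2 i k)⟩
  zero_mem' := ⟨MemLp.zero, fun _ _ => MemLp.zero⟩
  smul_mem' c _ hv := ⟨hv.1.const_smul c, fun i k => (hv.2 i k).const_smul c⟩

theorem memLp_coord {μ : Measure (Pt d)} {f : Pt d → Pt d} (hf : MemLp f 2 μ)
    (i : Fin d) : MemLp (fun x => f x i) 2 μ :=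
  (EuclideanSpace.proj (𝕜 := ℝ) i).comp_memLp' hf

/-- The products in the definition of the weak gradient are integrable. -/
theorem integrable_mul_test {U : Set (Pt d)} {F ζ : Pt d → ℝ} (hF : MemLp F 2 (vol U))
    (hζ : ContDiff ℝ ∞ ζ) (hc : HasCompactSupport ζ) (k : Fin d) :
    Integrable (fun x => F x * fderiv ℝ ζ x (e k)) (vol U) ∧
      Integrable (fun x => F x * ζ x) (vol U) := by
  constructor
  · refine MemLp.integrable_mul (p := 2) (q := 2) hF
      (Continuous.memLp_of_hasCompactSupport ?_ ?_)
    · exact (hζ.continuous_fderiv (by simp)).clm_apply continuous_const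
    · exact hc.fderiv_apply ℝ (e k)
  · exact MemLp.integrable_mul (p := 2) (q := 2) hF (hζ.continuous.memLp_of_hasCompactSupport hc)

theorem IsWeakGrad.add {U : Set (Pt d)} {v w : VF d} (hv : v ∈ L2Fields U) (hw : w ∈ L2Fields U)
    (h1 : IsWeakGrad U v.val v.grad) (h2 : IsWeakGrad U w.val w.grad) :
    IsWeakGrad U (v + w).val (v + w).grad := by
  intro ζ hζ hc hs i k
  have e1 := h1 ζ hζ hc hs i k
  have e2 := h2 ζ hζ hc hs i k
  have l : ∀ x, (v + w).val x i * fderiv ℝ ζ x (e k) =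
      v.val x i * fderiv ℝ ζ x (e k) + w.val x i * fderiv ℝ ζ x (e k) := by
    intro x; exact add_mul _ _ _
  have r : ∀ x, (v + w).grad x i k * ζ x = v.grad x i k * ζ x + w.grad x i k * ζ x := by
    intro x; exact add_mul _ _ _
  simp_rw [l, r]
  rw [integral_add, integral_add, e1, e2]
  · ring
  · exact (integrable_mul_test (hv.2 i k) hζ hc k).2
  · exact (integrable_mul_test (hw.2 i k) hζ hc k).2
  · exact (integrable_mul_test (memLp_coord hv.1 i) hζ hc k).1
  · exact (integrable_mul_test (memLp_coord hw.1 i) hζ hc k).1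

theorem IsWeakGrad.smul {U : Set (Pt d)} {v : VF d} (c : ℝ)
    (h1 : IsWeakGrad U v.val v.grad) : IsWeakGrad U (c • v).val (c • v).grad := by
  intro ζ hζ hc hs i k
  have l : ∀ x, (c • v).val x i * fderiv ℝ ζ x (e k) =
      c * (v.val x i * fderiv ℝ ζ x (e k)) := by
    intro x; exact mul_assoc _ _ _
  have r : ∀ x, (c • v).grad x i k * ζ x = c * (v.grad x i k * ζ x) := by
    intro x; exact mul_assoc _ _ _
  simp_rw [l, r]
  rw [integral_const_mul, integral_const_mul, h1 ζ hζ hc hs i k, mul_neg]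

theorem IsTraceOn.add {U S : Set (Pt d)} {v w : VF d} (hv : v ∈ L2Fields U) (hw : w ∈ L2Fields U)
    (hvt : MemLp v.tr 2 (surf S)) (hwt : MemLp w.tr 2 (surf S))
    (h1 : IsTraceOn U S v) (h2 : IsTraceOn U S w) : IsTraceOn U S (v + w) := by
  obtain ⟨p, hp, p1, p2, p3⟩ := h1
  obtain ⟨q, hq, q1, q2, q3⟩ := h2
  refine ⟨fun n => p n + q n, fun n => (hp n).add (hq n), ?_, fun i k => ?_, ?_⟩
  · have := tendsto_eLpNorm_add (fun n => (hp n).continuous.aestronglyMeasurable.sub hv.1.1)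
      (fun n => (hq n).continuous.aestronglyMeasurable.sub hw.1.1) p1 q1
    refine this.congr fun n => ?_
    congr 1
    show _ = p n + q n - (v.val + w.val)
    abel
  · have := tendsto_eLpNorm_add
      (fun n => (continuous_ofSmooth_grad (hp n) i k).aestronglyMeasurable.sub (hv.2 i k).1)
      (fun n => (continuous_ofSmooth_grad (hq n) i k).aestronglyMeasurable.sub (hw.2 i k).1)
      (p2 i k) (q2 i k)
    refine this.congr fun n => ?_
    congr 1
    funext x
    have hd : fderiv ℝ (p n + q n) x = fderiv ℝ (p n) x + fderiv ℝ (q n) x :=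
      fderiv_add ((hp n).differentiable (by simp) x) ((hq n).differentiable (by simp) x)
    show _ = fderiv ℝ (p n + q n) x (e k) i - (v.grad x i k + w.grad x i k)
    rw [hd]
    exact add_sub_add_comm _ _ _ _ |>.symm
  · have := tendsto_eLpNorm_add (fun n => (hp n).continuous.aestronglyMeasurable.sub hvt.1)
      (fun n => (hq n).continuous.aestronglyMeasurable.sub hwt.1) p3 q3
    refine this.congr fun n => ?_
    congr 1
    show _ = p n + q n - (v.tr + w.tr)
    abel

theorem IsTraceOn.smul {U S : Set (Pt d)} {v : VF d} (c : ℝ) (h1 : IsTraceOn U S v) :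
    IsTraceOn U S (c • v) := by
  obtain ⟨p, hp, p1, p2, p3⟩ := h1
  refine ⟨fun n => c • p n, fun n => (hp n).const_smul c, ?_, fun i k => ?_, ?_⟩
  · refine (tendsto_eLpNorm_const_smul c p1).congr fun n => ?_
    rw [smul_sub]; rfl
  · refine (tendsto_eLpNorm_const_smul c (p2 i k)).congr fun n => ?_
    congr 1
    funext x
    have hd : fderiv ℝ (c • p n) x = c • fderiv ℝ (p n) x :=
      fderiv_const_smul ((hp n).differentiable (by simp) x) c
    show _ = fderiv ℝ (c • p n) x (e k) i - c * v.grad x i k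
    rw [hd]
    exact mul_sub _ _ _
  · refine (tendsto_eLpNorm_const_smul c p3).congr fun n => ?_
    rw [smul_sub]; rfl

theorem IsH1.mem_L2Fields {Ω U : Set (Pt d)} {v : VF d} (hv : IsH1 Ω U v) : v ∈ L2Fields U :=
  ⟨hv.1, hv.2.1⟩

/-- `H¹_a(U)` as a linear space. -/
def H1aSpace (Ω Γa U : Set (Pt d)) : Submodule ℝ (VF d) where
  carrier := {v | IsH1a Ω Γa U v}
  add_mem' := by
    rintro v w ⟨hv, hv0⟩ ⟨hw, hw0⟩
    refine ⟨⟨hv.1.add hw.1, fun i k => (hv.2.1 i k).add (hw.2.1 i k), hv.2.2.1.add hw.2.2.1,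
      hv.2.2.2.1.add hv.mem_L2Fields hw.mem_L2Fields hw.2.2.2.1,
      hv.2.2.2.2.add hv.mem_L2Fields hw.mem_L2Fields hv.2.2.1 hw.2.2.1 hw.2.2.2.2⟩, ?_⟩
    filter_upwards [hv0, hw0] with x h1 h2
    show v.tr x + w.tr x = 0
    rw [h1, h2, add_zero]
  zero_mem' := by
    refine ⟨⟨MemLp.zero, fun _ _ => MemLp.zero, MemLp.zero, ?_, 0, fun _ => contDiff_const,
      ?_, fun i k => ?_, ?_⟩, ?_⟩
    · intro ζ _ _ _ i k
      show ∫ x in U, (0 : ℝ) * _ = -∫ x in U, (0 : ℝ) * _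
      simp
    · show Tendsto (fun _ => eLpNorm ((0 : Pt d → Pt d) - 0) 2 _) _ _
      simp
    · have : (fun x => (ofSmooth (0 : Pt d → Pt d)).grad x i k - (0 : VF d).grad x i k) = 0 := by
        funext x
        show fderiv ℝ (0 : Pt d → Pt d) x (e k) i - 0 = 0
        simp
      simp [this]
    · show Tendsto (fun _ => eLpNorm ((0 : Pt d → Pt d) - 0) 2 _) _ _
      simp
    · exact Eventually.of_forall fun _ => rfl
  smul_mem' := by
    rintro c v ⟨hv, hv0⟩
    refine ⟨⟨hv.1.const_smul c, fun i k => (hv.2.1 i k).const_smul c, hv.2.2.1.const_smul c,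
      hv.2.2.2.1.smul c, hv.2.2.2.2.smul c⟩, ?_⟩
    filter_upwards [hv0] with x h1
    show c • v.tr x = 0
    rw [h1, smul_zero]

/-- The restriction of an element of `H¹_a(Ω)` to a block belongs to `H¹_a` of the block. -/
theorem IsH1a.restrict {Ω Γa U : Set (Pt d)} (hΩ : IsOpen Ω) (hUΩ : U ⊆ Ω)
    (hΓ : Γa ⊆ frontier Ω) {v : VF d} (hv : IsH1a Ω Γa Ω v) : IsH1a Ω Γa U v := by
  obtain ⟨⟨h1, h2, h3, h4, w, hw, w1, w2, w3⟩, h0⟩ := hv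
  have hm : vol U ≤ vol Ω := Measure.restrict_mono hUΩ le_rfl
  have hsurf : surf (frontier U ∩ frontier Ω) ≤ surf (frontier Ω ∩ frontier Ω) :=
    Measure.restrict_mono (Set.subset_inter Set.inter_subset_right Set.inter_subset_right) le_rfl
  have hle : ∀ {E : Type} [NormedAddCommGroup E] {μ ν : Measure (Pt d)} {F : ℕ → Pt d → E},
      μ ≤ ν → Tendsto (fun n => eLpNorm (F n) 2 ν) atTop (𝓝 0) →
      Tendsto (fun n => eLpNorm (F n) 2 μ) atTop (𝓝 0) := fun hμν hF =>
    tendsto_of_tendsto_of_tendsto_of_le_of_le tendsto_const_nhds hF (fun _ => zero_le)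
      fun n => eLpNorm_mono_measure _ hμν
  refine ⟨⟨h1.mono_measure hm, fun i k => (h2 i k).mono_measure hm, h3.mono_measure hsurf, ?_,
    w, hw, hle hm w1, fun i k => hle hm (w2 i k), hle hsurf w3⟩, ?_⟩
  · intro ζ hζ hc hs i k
    -- The test function and its derivatives vanish off `U`, so both integrals may be taken over
    -- `Ω`.
    have hζ0 : ∀ x ∉ U, ζ x = 0 := fun x hx =>
      image_eq_zero_of_notMem_tsupport fun h => hx (hs h)
    have hdζ0 : ∀ x ∉ U, fderiv ℝ ζ x = 0 := fun x hx =>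
      image_eq_zero_of_notMem_tsupport fun h => hx (hs (tsupport_fderiv_subset ℝ h))
    have hext : ∀ F : Pt d → ℝ, (∀ x ∉ U, F x = 0) → ∫ x in U, F x = ∫ x in Ω, F x := by
      intro F hF
      exact (setIntegral_eq_of_subset_of_forall_sdiff_eq_zero hΩ.measurableSet hUΩ
        fun x hx => hF x hx.2).symm
    rw [hext _ fun x hx => by rw [hdζ0 x hx]; simp, hext _ fun x hx => by rw [hζ0 x hx, mul_zero]]
    exact h4 ζ hζ hc (hs.trans hUΩ) i k
  · refine ae_mono (Measure.restrict_mono ?_ le_rfl) h0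
    exact fun x hx => ⟨hΓ hx.2, hx.2⟩

/-! ### The energy form -/

variable {d : ℕ}

theorem IsLame.mono {Ω U : Set (Pt d)} {lam mu : Pt d → ℝ} (h : IsLame Ω lam mu) (hU : U ⊆ Ω) :
    IsLame U lam mu := by
  have hm : vol U ≤ vol Ω := Measure.restrict_mono hU le_rfl
  obtain ⟨c, C, hc, hb⟩ := h.bounds
  exact ⟨h.meas_lam.mono_measure hm, h.meas_mu.mono_measure hm, c, C, hc, ae_mono hm hb⟩

theorem IsLame.memLp_lam {U : Set (Pt d)} {lam mu : Pt d → ℝ} (h : IsLame U lam mu) :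
    MemLp lam ⊤ (vol U) := by
  obtain ⟨c, C, hc, hb⟩ := h.bounds
  exact memLp_top_of_bound h.meas_lam C (hb.mono fun x hx => hx.2.2.2)

theorem IsLame.memLp_mu {U : Set (Pt d)} {lam mu : Pt d → ℝ} (h : IsLame U lam mu) :
    MemLp mu ⊤ (vol U) := by
  obtain ⟨c, C, hc, hb⟩ := h.bounds
  refine memLp_top_of_bound h.meas_mu C (hb.mono fun x hx => ?_)
  rw [Real.norm_of_nonneg (hc.le.trans hx.1)]
  exact hx.2.2.1

/-- The energy density as a manifestly symmetric expression. -/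
theorem sum_stress_mul_strain (lam mu : Pt d → ℝ) (v w : VF d) (x : Pt d) :
    ∑ i, ∑ k, stress lam mu v x i k * strain w x i k =
      mu x * (2 * ∑ i, ∑ k, strain v x i k * strain w x i k) + lam x * (div v x * div w x) := by
  have hdiv : div w x = ∑ i, strain w x i i :=
    Finset.sum_congr rfl fun i _ => by simp [strain]
  simp only [stress, add_mul, Finset.sum_add_distrib, ite_mul, zero_mul, Finset.sum_ite_eq,
    Finset.mem_univ, if_true]
  congr 1
  · simp only [Finset.mul_sum]
    exact Finset.sum_congr rfl fun i _ => Finset.sum_congr rfl fun k _ => by ring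
  · rw [hdiv, Finset.mul_sum, Finset.mul_sum]
    exact Finset.sum_congr rfl fun i _ => by ring

/-- The stress is a symmetric tensor, so it only sees the symmetric part of a gradient. -/
theorem stressGrad_eq_aForm (lam mu : Pt d → ℝ) (U : Set (Pt d)) (v w : VF d) :
    stressGrad lam mu U v w = aForm lam mu U v w := by
  unfold stressGrad aForm
  congr 1
  funext x
  have hsymm : ∀ i k, stress lam mu v x i k = stress lam mu v x k i := by
    intro i k
    simp only [stress, strain, eq_comm (a := i) (b := k), add_comm]
  have h1 : ∑ i, ∑ k, stress lam mu v x i k * w.grad x k i =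
      ∑ i, ∑ k, stress lam mu v x i k * w.grad x i k := by
    rw [Finset.sum_comm]
    exact Finset.sum_congr rfl fun i _ => Finset.sum_congr rfl fun k _ => by rw [hsymm]
  have h2 : ∑ i, ∑ k, stress lam mu v x i k * strain w x i k =
      (∑ i, ∑ k, stress lam mu v x i k * w.grad x i k +
        ∑ i, ∑ k, stress lam mu v x i k * w.grad x k i) / 2 := by
    rw [← Finset.sum_add_distrib, Finset.sum_div]
    refine Finset.sum_congr rfl fun i _ => ?_
    rw [← Finset.sum_add_distrib, Finset.sum_div]
    refine Finset.sum_congr rfl fun k _ => ?_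
    rw [strain]; ring
  rw [h2, h1]; ring

theorem memLp_strain {U : Set (Pt d)} {v : VF d} (hv : v ∈ L2Fields U) (i k : Fin d) :
    MemLp (fun x => strain v x i k) 2 (vol U) := by
  have := ((hv.2 i k).add (hv.2 k i)).const_mul (1 / 2)
  refine this.ae_eq (Eventually.of_forall fun x => ?_)
  show 1 / 2 * (v.grad x i k + v.grad x k i) = (v.grad x i k + v.grad x k i) / 2
  ring

theorem memLp_div {U : Set (Pt d)} {v : VF d} (hv : v ∈ L2Fields U) :
    MemLp (fun x => div v x) 2 (vol U) :=
  memLp_finsetSum _ fun i _ => hv.2 i i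

theorem integrable_energy {U : Set (Pt d)} {lam mu : Pt d → ℝ} (hL : IsLame U lam mu)
    {v w : VF d} (hv : v ∈ L2Fields U) (hw : w ∈ L2Fields U) :
    Integrable (fun x => ∑ i, ∑ k, stress lam mu v x i k * strain w x i k) (vol U) := by
  simp_rw [sum_stress_mul_strain]
  refine (integrable_bdd_mul hL.memLp_mu (Integrable.const_mul ?_ 2)).add
    (integrable_bdd_mul hL.memLp_lam (MemLp.integrable_mul (memLp_div hv) (memLp_div hw)))
  exact integrable_finsetSum _ fun i _ => integrable_finsetSum _ fun k _ =>
    MemLp.integrable_mul (memLp_strain hv i k) (memLp_strain hw i k)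

theorem aForm_comm (lam mu : Pt d → ℝ) (U : Set (Pt d)) (v w : VF d) :
    aForm lam mu U v w = aForm lam mu U w v := by
  unfold aForm
  congr 1
  funext x
  rw [sum_stress_mul_strain, sum_stress_mul_strain, mul_comm (div v x)]
  simp only [fun i k => mul_comm (strain v x i k) (strain w x i k)]

theorem stress_add (lam mu : Pt d → ℝ) (v w : VF d) (x : Pt d) (i k : Fin d) :
    stress lam mu (v + w) x i k = stress lam mu v x i k + stress lam mu w x i k := by
  have h1 : strain (v + w) x i k = strain v x i k + strain w x i k := by
    show (v.grad x i k + w.grad x i k + (v.grad x k i + w.grad x k i)) / 2 = _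
    simp only [strain]; ring
  have h2 : div (v + w) x = div v x + div w x :=
    Finset.sum_add_distrib (f := fun l => v.grad x l l) (g := fun l => w.grad x l l)
  simp only [stress, h1, h2]
  split_ifs <;> ring

theorem stress_smul (lam mu : Pt d → ℝ) (c : ℝ) (v : VF d) (x : Pt d) (i k : Fin d) :
    stress lam mu (c • v) x i k = c * stress lam mu v x i k := by
  have h1 : strain (c • v) x i k = c * strain v x i k := by
    show (c * v.grad x i k + c * v.grad x k i) / 2 = _
    simp only [strain]; ring
  have h2 : div (c • v) x = c * div v x :=
    (Finset.mul_sum Finset.univ (fun l => v.grad x l l) c).symm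
  simp only [stress, h1, h2]
  split_ifs <;> ring

theorem aForm_add_left {U : Set (Pt d)} {lam mu : Pt d → ℝ} (hL : IsLame U lam mu) {v v' w : VF d}
    (hv : v ∈ L2Fields U) (hv' : v' ∈ L2Fields U) (hw : w ∈ L2Fields U) :
    aForm lam mu U (v + v') w = aForm lam mu U v w + aForm lam mu U v' w := by
  unfold aForm
  rw [← integral_add (integrable_energy hL hv hw) (integrable_energy hL hv' hw)]
  simp only [stress_add, add_mul, Finset.sum_add_distrib]

theorem aForm_smul_left (lam mu : Pt d → ℝ) (U : Set (Pt d)) (c : ℝ) (v w : VF d) :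
    aForm lam mu U (c • v) w = c * aForm lam mu U v w := by
  unfold aForm
  rw [← integral_const_mul]
  simp only [stress_smul, Finset.mul_sum, mul_assoc]

/-- Positivity of the elasticity tensor, from `μ ≥ 0`, `2μ + dλ ≥ 0` and
`(tr ε)² ≤ d |ε|²`. -/
theorem aForm_nonneg {U : Set (Pt d)} {lam mu : Pt d → ℝ} (hL : IsLame U lam mu) (v : VF d) :
    0 ≤ aForm lam mu U v v := by
  obtain ⟨c, C, hc, hb⟩ := hL.bounds
  refine integral_nonneg_of_ae (hb.mono fun x hx => ?_)
  obtain ⟨h1, h2, -, -⟩ := hx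
  simp only [Pi.zero_apply, sum_stress_mul_strain]
  set S : ℝ := ∑ i, ∑ k, strain v x i k * strain v x i k
  have hS0 : 0 ≤ S := Finset.sum_nonneg fun i _ => Finset.sum_nonneg fun k _ => mul_self_nonneg _
  have htr : div v x * div v x ≤ d * S := by
    have hdiv : div v x = ∑ i, strain v x i i :=
      Finset.sum_congr rfl fun i _ => by simp [strain]
    have h3 : (∑ i, strain v x i i) ^ 2 ≤ d * ∑ i, strain v x i i ^ 2 := by
      simpa using sq_sum_le_card_mul_sum_sq (s := Finset.univ) (f := fun i => strain v x i i)
    have h4 : ∑ i, strain v x i i ^ 2 ≤ S := by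
      refine Finset.sum_le_sum fun i _ => ?_
      rw [sq]
      exact Finset.single_le_sum (f := fun k => strain v x i k * strain v x i k)
        (fun k _ => mul_self_nonneg _) (Finset.mem_univ i)
    rw [hdiv, ← sq]
    exact h3.trans (mul_le_mul_of_nonneg_left h4 (Nat.cast_nonneg d))
  rcases le_total 0 (lam x) with hl | hl
  · have := mul_nonneg hl (mul_self_nonneg (div v x))
    have := mul_nonneg (hc.le.trans h1) hS0
    linarith
  · nlinarith [mul_le_mul_of_nonpos_left htr hl, mul_nonneg (hc.le.trans h2) hS0]

/-- The energy form as a bilinear form on a space of square integrable fields. -/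
def energyForm {U : Set (Pt d)} {lam mu : Pt d → ℝ} (hL : IsLame U lam mu)
    {S : Submodule ℝ (VF d)} (hS : S ≤ L2Fields U) : LinearMap.BilinForm ℝ S :=
  LinearMap.mk₂ ℝ (fun v w => aForm lam mu U v w)
    (fun v v' w => aForm_add_left hL (hS v.2) (hS v'.2) (hS w.2))
    (fun c v w => aForm_smul_left lam mu U c v w)
    (fun v w w' => by
      simp only [aForm_comm lam mu U v]
      exact aForm_add_left hL (hS w.2) (hS w'.2) (hS v.2))
    (fun c v w => by
      simp only [aForm_comm lam mu U v]
      exact aForm_smul_left lam mu U c w v)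

/-! ### The weighted mass form -/

theorem integrable_mass {U : Set (Pt d)} {κ : Pt d → ℝ} (hκ : MemLp κ ⊤ (vol U)) {v w : VF d}
    (hv : v ∈ L2Fields U) (hw : w ∈ L2Fields U) :
    Integrable (fun x => κ x * inner ℝ (v.val x) (w.val x)) (vol U) :=
  integrable_bdd_mul hκ (integrable_inner hv.1 hw.1)

theorem sBlock_comm (κ : Pt d → ℝ) (U : Set (Pt d)) (v w : VF d) :
    sBlock κ U v w = sBlock κ U w v := by
  simp only [sBlock, real_inner_comm]

theorem sBlock_add_left {U : Set (Pt d)} {κ : Pt d → ℝ} (hκ : MemLp κ ⊤ (vol U)) {v v' w : VF d}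
    (hv : v ∈ L2Fields U) (hv' : v' ∈ L2Fields U) (hw : w ∈ L2Fields U) :
    sBlock κ U (v + v') w = sBlock κ U v w + sBlock κ U v' w := by
  unfold sBlock
  rw [← integral_add (integrable_mass hκ hv hw) (integrable_mass hκ hv' hw)]
  congr 1
  funext x
  show κ x * inner ℝ (v.val x + v'.val x) (w.val x) = _
  rw [inner_add_left, mul_add]

theorem sBlock_smul_left (κ : Pt d → ℝ) (U : Set (Pt d)) (c : ℝ) (v w : VF d) :
    sBlock κ U (c • v) w = c * sBlock κ U v w := by
  unfold sBlock
  rw [← integral_const_mul]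
  congr 1
  funext x
  show κ x * inner ℝ (c • v.val x) (w.val x) = _
  rw [real_inner_smul_left]; ring

theorem sBlock_sub_left {U : Set (Pt d)} {κ : Pt d → ℝ} (hκ : MemLp κ ⊤ (vol U)) {v v' w : VF d}
    (hv : v ∈ L2Fields U) (hv' : v' ∈ L2Fields U) (hw : w ∈ L2Fields U) :
    sBlock κ U (v - v') w = sBlock κ U v w - sBlock κ U v' w := by
  rw [sub_eq_add_neg, ← neg_one_smul ℝ v', sBlock_add_left hκ hv ((L2Fields U).smul_mem _ hv') hw,
    sBlock_smul_left]
  ring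

theorem sBlock_zero_left (κ : Pt d → ℝ) (U : Set (Pt d)) (w : VF d) : sBlock κ U 0 w = 0 := by
  simpa using sBlock_smul_left κ U 0 0 w

theorem sBlock_self_nonneg {U : Set (Pt d)} {κ : Pt d → ℝ} (hκ0 : ∀ᵐ x ∂(vol U), 0 ≤ κ x)
    (v : VF d) : 0 ≤ sBlock κ U v v :=
  integral_nonneg_of_ae (hκ0.mono fun _ hx => mul_nonneg hx real_inner_self_nonneg)

/-- The weighted mass form as a bilinear form on a space of square integrable fields. -/
def massForm {U : Set (Pt d)} {κ : Pt d → ℝ} (hκ : MemLp κ ⊤ (vol U))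
    {S : Submodule ℝ (VF d)} (hS : S ≤ L2Fields U) : LinearMap.BilinForm ℝ S :=
  LinearMap.mk₂ ℝ (fun v w => sBlock κ U v w)
    (fun v v' w => sBlock_add_left hκ (hS v.2) (hS v'.2) (hS w.2))
    (fun c v w => sBlock_smul_left κ U c v w)
    (fun v w w' => by
      simp only [sBlock_comm κ U v]
      exact sBlock_add_left hκ (hS w.2) (hS w'.2) (hS v.2))
    (fun c v w => by
      simp only [sBlock_comm κ U v]
      exact sBlock_smul_left κ U c w v)

/-- The weight `κ̃` is bounded, since Lipschitz functions have bounded gradients. -/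
theorem memLp_kappa {Ω : Set (Pt d)} (hΩ : IsOpen Ω) {lam mu : Pt d → ℝ} (hL : IsLame Ω lam mu)
    {τ : Type*} [Fintype τ] {χ : τ → Pt d → ℝ} (hχ : IsPartitionOfUnity Ω χ) :
    MemLp (kappa lam mu χ) ⊤ (vol Ω) := by
  refine memLp_finsetSum _ fun i _ => ?_
  have hn : ∀ x, inner ℝ (gradient (χ i) x) (gradient (χ i) x) = ‖fderiv ℝ (χ i) x‖ ^ 2 := by
    intro x
    rw [real_inner_self_eq_norm_sq, gradient, LinearIsometryEquiv.norm_map]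
  simp_rw [hn]
  refine MemLp.mul' (p := ⊤) (q := ⊤) ?_ (hL.memLp_lam.add (hL.memLp_mu.const_mul 2))
  obtain ⟨L, hLip⟩ := hχ.lipschitz i
  refine memLp_top_of_bound ((measurable_fderiv ℝ (χ i)).norm.pow_const 2).aestronglyMeasurable
    ((L : ℝ) ^ 2) ?_
  refine (ae_restrict_mem hΩ.measurableSet).mono fun x hx => ?_
  have := norm_fderiv_le_of_lipschitzOn ℝ (hΩ.mem_nhds hx) hLip
  rw [Real.norm_of_nonneg (by positivity)]
  gcongr

/-- The Rayleigh quotient on a block of a function `s`-orthogonal to the first `n` eigenfunctions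
is at least the first excluded eigenvalue. -/
theorem IsEigenSystem.le_rayleigh {U : Set (Pt d)} {lam mu κ : Pt d → ℝ} {V : Submodule ℝ (VF d)}
    {θ : ℕ → ℝ} {φ : ℕ → VF d} (hφ : IsEigenSystem lam mu κ U V θ φ) (hL : IsLame U lam mu)
    (hκ : MemLp κ ⊤ (vol U)) (hκ0 : ∀ᵐ x ∂(vol U), 0 ≤ κ x) (hV : V ≤ L2Fields U)
    (n : ℕ) {w : VF d} (hw : w ∈ V) (horth : ∀ i < n, sBlock κ U w (φ i) = 0) :
    θ n * sBlock κ U w w ≤ aForm lam mu U w w := by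
  refine spectral_gap (energyForm hL hV) (massForm hκ hV) (fun x y => aForm_comm ..)
    (fun x => aForm_nonneg hL _) (fun x y => sBlock_comm ..) (fun x => sBlock_self_nonneg hκ0 _)
    θ (fun i => ⟨φ i, hφ.mem i⟩) (fun i v => hφ.eigen i v v.2) hφ.mono hφ.ne_zero hφ.orth ?_
    n ⟨w, hw⟩ horth
  intro v δ hδ
  obtain ⟨y, hy, hyδ⟩ := hφ.complete v v.2 δ hδ
  obtain ⟨c, rfl⟩ := Finsupp.mem_span_range_iff_exists_finsupp.1 hy
  refine ⟨c.support, c, ?_⟩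
  have : ((v - ∑ i ∈ c.support, c i • (⟨φ i, hφ.mem i⟩ : V) : V) : VF d) =
      v - c.sum fun i a => a • φ i := by
    simp [Finsupp.sum]
  show sBlock κ U (v - ∑ i ∈ c.support, c i • (⟨φ i, hφ.mem i⟩ : V) : V)
    (v - ∑ i ∈ c.support, c i • (⟨φ i, hφ.mem i⟩ : V) : V) < δ
  rw [this]
  exact hyδ

/-! ### Integrals over a coarse grid -/

section Grid

variable {ι : Type*} [Fintype ι] {Ω : Set (Pt d)} {K : ι → Set (Pt d)}

theorem IsCoarseGrid.setIntegral_eq_sum (hK : IsCoarseGrid Ω K) {F : Pt d → ℝ}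
    (hF : Integrable F (vol Ω)) : ∫ x in Ω, F x = ∑ j, ∫ x in K j, F x := by
  have hsub : (⋃ j, K j) ⊆ Ω := Set.iUnion_subset hK.subset
  have hae : (Ω : Set (Pt d)) =ᵐ[volume] ⋃ j, K j :=
    (ae_le_set.2 hK.null).antisymm hsub.eventuallyLE
  rw [setIntegral_congr_set hae]
  exact integral_iUnion_fintype (fun j => (hK.lipschitz j).1.measurableSet)
    (fun i j hij => hK.disjoint i j hij)
    fun j => IntegrableOn.mono_set (t := Ω) hF (hK.subset j)

theorem IsCoarseGrid.aForm_eq_sum (hK : IsCoarseGrid Ω K) {lam mu : Pt d → ℝ}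
    (hL : IsLame Ω lam mu) {v w : VF d} (hv : v ∈ L2Fields Ω) (hw : w ∈ L2Fields Ω) :
    aForm lam mu Ω v w = ∑ j, aForm lam mu (K j) v w :=
  hK.setIntegral_eq_sum (integrable_energy hL hv hw)

/-- The boundaries of the blocks cover `∂Ω` without essential overlap, so that the Neumann loads of
the blocks add up to the Neumann load of `Ω`. -/
theorem IsCoarseGrid.sum_neumannLoad (hK : IsCoarseGrid Ω K) (hΩ : IsOpen Ω) {Γb : Set (Pt d)}
    (hΓb : MeasurableSet Γb) (hΓ : Γb ⊆ frontier Ω) {g : Pt d → Pt d} {w : VF d}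
    (hg : MemLp g 2 (surf Γb)) (hw : MemLp w.tr 2 (surf Γb)) :
    ∑ j, neumannLoad Γb g (K j) w = ∫ x, inner ℝ (g x) (w.tr x) ∂(surf Γb) := by
  have hcover : Γb = ⋃ j, frontier (K j) ∩ Γb := by
    refine Set.Subset.antisymm (fun x hx => ?_) (Set.iUnion_subset fun j => Set.inter_subset_right)
    have hxΩ := hΓ hx
    have hcl : x ∈ ⋃ j, closure (K j) := hK.cover ▸ frontier_subset_closure hxΩ
    obtain ⟨j, hj⟩ := Set.mem_iUnion.1 hcl
    refine Set.mem_iUnion.2 ⟨j, ⟨hj, fun hint => ?_⟩, hx⟩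
    rw [hΩ.frontier_eq] at hxΩ
    exact hxΩ.2 (hK.subset j (interior_subset hint))
  have hint : IntegrableOn (fun x => inner ℝ (g x) (w.tr x)) (⋃ j, frontier (K j) ∩ Γb)
      (Measure.euclideanHausdorffMeasure (d - 1)) := by
    rw [← hcover]
    exact integrable_inner hg hw
  have h := integral_iUnion_ae (fun j =>
    ((isClosed_frontier (s := K j)).measurableSet.inter hΓb).nullMeasurableSet) ?_ hint
  · rw [← hcover, tsum_fintype] at h
    exact h.symm
  · intro i j hij
    refine measure_mono_null ?_ (hK.boundary_null i j hij)
    exact fun x hx => ⟨⟨hx.1.1, hx.2.1⟩, hΓ hx.1.2⟩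

end Grid

/-! ### The auxiliary space and the multiscale basis -/

section Multiscale

variable {d : ℕ} {ι : Type*} [DecidableEq ι] {K : ι → Set (Pt d)} {κ : Pt d → ℝ}
  {φ : ι → ℕ → VF d} {n : ι → ℕ}

theorem single_mem_auxSpace {j : ι} {i : ℕ} (hi : i < n j) :
    (Pi.single j (φ j i) : ι → VF d) ∈ auxSpace φ n := by
  refine (Submodule.mem_pi).2 fun j' _ => ?_
  by_cases h : j' = j
  · subst h
    rw [Pi.single_eq_same]
    exact Submodule.subset_span ⟨i, hi, rfl⟩
  · rw [Pi.single_eq_of_ne h]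
    exact Submodule.zero_mem _

variable [Fintype ι]

theorem sForm_single (z : ι → VF d) (j : ι) (q : VF d) :
    sForm κ K z (Pi.single j q) = sBlock κ (K j) (z j) q := by
  rw [sForm, Finset.sum_eq_single j]
  · rw [Pi.single_eq_same]
  · intro j' _ h
    rw [Pi.single_eq_of_ne h, sBlock_comm, sBlock_zero_left]
  · exact fun h => absurd (Finset.mem_univ j) h

/-- Orthogonality to `V_aux` may be tested on the eigenfunctions. -/
theorem sForm_eq_zero_iff (hκ : ∀ j, MemLp κ ⊤ (vol (K j))) (hφ : ∀ j i, φ j i ∈ L2Fields (K j))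
    {z : ι → VF d} (hz : ∀ j, z j ∈ L2Fields (K j)) :
    (∀ z' ∈ auxSpace φ n, sForm κ K z z' = 0) ↔
      ∀ j, ∀ i < n j, sBlock κ (K j) (z j) (φ j i) = 0 := by
  constructor
  · intro h j i hi
    rw [← sForm_single]
    exact h _ (single_mem_auxSpace hi)
  · intro h z' hz'
    refine Finset.sum_eq_zero fun j _ => ?_
    have hspan : Submodule.span ℝ (φ j '' Set.Iio (n j)) ≤ L2Fields (K j) :=
      Submodule.span_le.2 (by rintro _ ⟨i, -, rfl⟩; exact hφ j i)
    rw [sBlock_comm]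
    refine Submodule.span_induction (p := fun y _ => sBlock κ (K j) y (z j) = 0) ?_ ?_ ?_ ?_
      (Submodule.mem_pi.1 hz' j (Set.mem_univ j))
    · rintro _ ⟨i, hi, rfl⟩
      rw [sBlock_comm]
      exact h j i hi
    · exact sBlock_zero_left ..
    · intro y y' hy hy' h1 h2
      rw [sBlock_add_left (hκ j) (hspan hy) (hspan hy') (hz j), h1, h2, add_zero]
    · intro c y _ h1
      rw [sBlock_smul_left, h1, mul_zero]

variable {Ω Γa : Set (Pt d)} {lam mu : Pt d → ℝ}

theorem H1aSpace_le_L2Fields : H1aSpace Ω Γa Ω ≤ L2Fields Ω := fun _ hv => hv.1.mem_L2Fields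

theorem L2Fields_mono {U : Set (Pt d)} (h : U ⊆ Ω) : L2Fields Ω ≤ L2Fields U := fun _ hv =>
  have hm : vol U ≤ vol Ω := Measure.restrict_mono h le_rfl
  ⟨hv.1.mono_measure hm, fun i k => (hv.2 i k).mono_measure hm⟩

/-- The moments of a basis function against the eigenfunctions of a block are those of the
eigenfunction to which it belongs. -/
theorem IsGlobalBasis.sBlock_eq (hκ : ∀ j, MemLp κ ⊤ (vol (K j))) (hK : ∀ j, K j ⊆ Ω)
    (hφ : ∀ j i, φ j i ∈ L2Fields (K j)) {q : ι → VF d} (hq : ∀ j, q j ∈ L2Fields (K j)) {ξ : VF d}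
    (hξ : IsGlobalBasis Ω Γa lam mu κ K (auxSpace φ n) q ξ) {j : ι} {i : ℕ} (hi : i < n j) :
    sBlock κ (K j) ξ (φ j i) = sBlock κ (K j) (q j) (φ j i) := by
  have hmem : ξ ∈ L2Fields (K j) := L2Fields_mono (hK j) hξ.mem.1.mem_L2Fields
  have h := hξ.constraint _ (single_mem_auxSpace hi)
  rw [sForm_single] at h
  have h' := sBlock_sub_left (hκ j) hmem (hq j) (hφ j i)
  exact sub_eq_zero.1 (h'.symm.trans h)

/-- The basis functions are energy-orthogonal to the functions with vanishing moments against the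
eigenfunctions. -/
theorem IsGlobalBasis.orthogonal (hL : IsLame Ω lam mu) (hκ : ∀ j, MemLp κ ⊤ (vol (K j)))
    (hK : ∀ j, K j ⊆ Ω) (hφ : ∀ j i, φ j i ∈ L2Fields (K j)) {q : ι → VF d}
    (hq : ∀ j, q j ∈ L2Fields (K j)) {ξ : VF d}
    (hξ : IsGlobalBasis Ω Γa lam mu κ K (auxSpace φ n) q ξ) {w : VF d} (hw : IsH1a Ω Γa Ω w)
    (hw0 : ∀ j, ∀ i < n j, sBlock κ (K j) w (φ j i) = 0) : aForm lam mu Ω ξ w = 0 := by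
  have hL2 : ∀ {v : VF d}, IsH1a Ω Γa Ω v → ∀ j, v ∈ L2Fields (K j) := fun hv j =>
    L2Fields_mono (hK j) hv.1.mem_L2Fields
  refine orthogonal_of_minimal (energyForm hL (H1aSpace_le_L2Fields (Γa := Γa)))
    (fun x y => aForm_comm ..) ⟨ξ, hξ.mem⟩ ⟨w, hw⟩ fun t => ?_
  have hmem : IsH1a Ω Γa Ω (ξ + t • w) :=
    (H1aSpace Ω Γa Ω).add_mem hξ.mem ((H1aSpace Ω Γa Ω).smul_mem t hw)
  refine hξ.minimal (ξ + t • w) hmem ?_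
  refine (sForm_eq_zero_iff hκ hφ fun j => (L2Fields (K j)).sub_mem (hL2 hmem j) (hq j)).2 ?_
  intro j i hi
  show sBlock κ (K j) (ξ + t • w - q j) (φ j i) = 0
  rw [sBlock_sub_left (hκ j) (hL2 hmem j) (hq j) (hφ j i),
    sBlock_add_left (hκ j) (hL2 hξ.mem j) ((L2Fields (K j)).smul_mem t (hL2 hw j)) (hφ j i),
    sBlock_smul_left, hw0 j i hi, hξ.sBlock_eq hκ hK hφ hq hi]
  ring

/-- A function that is energy-orthogonal to `V_glo` agrees, up to a function of zero energy, with a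
function whose moments against the eigenfunctions vanish. The two differ by an element of `V_glo`,
which need not vanish when `Γ_a` has no surface area; no Korn inequality is needed. -/
theorem exists_zero_moments (hL : IsLame Ω lam mu) (hκ : ∀ j, MemLp κ ⊤ (vol (K j)))
    (hK : ∀ j, K j ⊆ Ω) (hφ : ∀ j i, φ j i ∈ L2Fields (K j))
    (hpos : ∀ j i, 0 < sBlock κ (K j) (φ j i) (φ j i))
    (horth : ∀ j i i', i ≠ i' → sBlock κ (K j) (φ j i) (φ j i') = 0) {ξ : ι → ℕ → VF d}
    (hξ : ∀ j, ∀ i < n j, IsGlobalBasis Ω Γa lam mu κ K (auxSpace φ n)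
      (Pi.single j (φ j i)) (ξ j i))
    {e : VF d} (he : IsH1a Ω Γa Ω e) (he0 : ∀ j, ∀ i < n j, aForm lam mu Ω e (ξ j i) = 0) :
    ∃ w, IsH1a Ω Γa Ω w ∧ (∀ j, ∀ i < n j, sBlock κ (K j) w (φ j i) = 0) ∧
      aForm lam mu Ω e e = aForm lam mu Ω w w ∧ aForm lam mu Ω e e = aForm lam mu Ω e w := by
  have hq : ∀ j i j', (Pi.single j (φ j i) : ι → VF d) j' ∈ L2Fields (K j') := by
    intro j i j'
    by_cases h : j' = j
    · subst h
      rw [Pi.single_eq_same]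
      exact hφ _ i
    · rw [Pi.single_eq_of_ne h]
      exact Submodule.zero_mem _
  have hX : ∀ j, H1aSpace Ω Γa Ω ≤ L2Fields (K j) := fun j =>
    H1aSpace_le_L2Fields.trans (L2Fields_mono (hK j))
  let p : (Σ j, Fin (n j)) → H1aSpace Ω Γa Ω →ₗ[ℝ] ℝ := fun k =>
    { toFun := fun v => sBlock κ (K k.1) v (φ k.1 k.2)
      map_add' := fun v w => sBlock_add_left (hκ _) (hX _ v.2) (hX _ w.2) (hφ _ _)
      map_smul' := fun c v => sBlock_smul_left .. }
  have hp : ∀ k k' : (Σ j, Fin (n j)), p k' ⟨ξ k.1 k.2, (hξ k.1 k.2 k.2.2).mem⟩ =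
      if k = k' then sBlock κ (K k.1) (φ k.1 k.2) (φ k.1 k.2) else 0 := by
    rintro ⟨j, i, hi⟩ ⟨j', i', hi'⟩
    refine ((hξ j i hi).sBlock_eq hκ hK hφ (hq j i) hi').trans ?_
    by_cases hj : j' = j
    · subst hj
      rw [Pi.single_eq_same]
      by_cases hii : i = i'
      · subst hii
        rw [if_pos rfl]
      · rw [if_neg (by simpa using hii), horth _ _ _ hii]
    · rw [Pi.single_eq_of_ne hj, sBlock_zero_left, if_neg]
      intro h
      exact hj (congrArg Sigma.fst h).symm
  obtain ⟨w, hw0, hw1, hw2⟩ := exists_mem_ker_of_orthogonal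
    (energyForm hL (H1aSpace_le_L2Fields (Γa := Γa))) p
    (fun k => ⟨ξ k.1 k.2, (hξ k.1 k.2 k.2.2).mem⟩) _ (fun k => (hpos k.1 k.2).ne') hp
    (fun k w hw => (hξ k.1 k.2 k.2.2).orthogonal hL hκ hK hφ (hq _ _) w.2
      fun j i hi => hw ⟨j, i, hi⟩)
    ⟨e, he⟩ (fun k => he0 k.1 k.2 k.2.2)
  exact ⟨w, w.2, fun j i hi => hw0 ⟨j, i, hi⟩, hw1, hw2⟩

/-- Energy of a sum of correctors against a function whose moments against the eigenfunctions
vanish: the multipliers drop out and only the loads remain. -/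
theorem aForm_sum_corrector (hL : IsLame Ω lam mu) (hκ : ∀ j, MemLp κ ⊤ (vol (K j)))
    (hK : ∀ j, K j ⊆ Ω) (hφ : ∀ j i, φ j i ∈ L2Fields (K j)) {ℓ : ι → VF d → ℝ} {R : ι → VF d}
    (hR : ∀ j, IsGlobalCorrector Ω Γa lam mu κ K (auxSpace φ n) (ℓ j) j (R j))
    {w : VF d} (hw : IsH1a Ω Γa Ω w)
    (hw0 : ∀ j, ∀ i < n j, sBlock κ (K j) w (φ j i) = 0) :
    aForm lam mu Ω (∑ j, R j) w = ∑ j, ℓ j w := by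
  have hsum : aForm lam mu Ω (∑ j, R j) w = ∑ j, aForm lam mu Ω (R j) w := by
    have := LinearMap.congr_fun (map_sum (energyForm hL (H1aSpace_le_L2Fields (Γa := Γa)))
      (fun j => ⟨R j, (hR j).mem⟩) Finset.univ) ⟨w, hw⟩
    rw [LinearMap.sum_apply] at this
    refine Eq.trans ?_ this
    show _ = aForm lam mu Ω ((∑ j, (⟨R j, (hR j).mem⟩ : H1aSpace Ω Γa Ω) : _) : VF d) w
    simp
  rw [hsum]
  refine Finset.sum_congr rfl fun j _ => ?_
  obtain ⟨ϑ, hϑ, h⟩ := (hR j).eq_energy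
  have h0 : sForm κ K (toBlocks ι w) ϑ = 0 := (sForm_eq_zero_iff (z := toBlocks ι w) hκ hφ
    fun j => L2Fields_mono (hK j) hw.1.mem_L2Fields).2 hw0 ϑ hϑ
  rw [← h w hw, h0, add_zero]

end Multiscale

/-! ### From the energy identity to the error bound -/

/-- If `E = -∫ f · w` and `Λ ∫ κ |w|² ≤ E`, then `E ≤ Λ⁻¹ ∫ κ⁻¹ |f|²`, by Young's inequality under
the integral sign. -/
theorem energy_le_of_load {d : ℕ} {Ω : Set (Pt d)} {κ : Pt d → ℝ} {f : Pt d → Pt d} {w : VF d}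
    {E Λ : ℝ} (hΛ : 0 < Λ) (hκ : MemLp κ ⊤ (vol Ω)) (hκ0 : ∀ᵐ x ∂(vol Ω), 0 < κ x)
    (hfL2 : MemLp f 2 (vol Ω)) (hf : Integrable (fun x => (κ x)⁻¹ * ‖f x‖ ^ 2) (vol Ω))
    (hw : w ∈ L2Fields Ω)
    (hE : E = -∫ x in Ω, inner ℝ (f x) (w.val x)) (hgap : Λ * sBlock κ Ω w w ≤ E) :
    E ≤ Λ⁻¹ * ∫ x in Ω, (κ x)⁻¹ * ‖f x‖ ^ 2 := by
  have hyoung : E ≤ Λ⁻¹ / 2 * (∫ x in Ω, (κ x)⁻¹ * ‖f x‖ ^ 2) + Λ / 2 * sBlock κ Ω w w := by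
    rw [hE, sBlock, ← integral_const_mul, ← integral_const_mul, ← integral_neg,
      ← integral_add (hf.const_mul _) ((integrable_mass hκ hw hw).const_mul _)]
    refine integral_mono_ae (integrable_inner hfL2 hw.1).neg
      ((hf.const_mul _).add ((integrable_mass hκ hw hw).const_mul _)) (hκ0.mono fun x hx => ?_)
    -- Expand `|f + Λ κ w|² ≥ 0` and divide by `2 Λ κ`.
    have h1 : 0 ≤ (2 * Λ * κ x)⁻¹ * ‖f x + (Λ * κ x) • w.val x‖ ^ 2 := by positivity
    rw [norm_add_sq_real, norm_smul, mul_pow, Real.norm_eq_abs, sq_abs, inner_smul_right] at h1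
    have h2 : (2 * Λ * κ x)⁻¹ * (‖f x‖ ^ 2 + 2 * (Λ * κ x * inner ℝ (f x) (w.val x)) +
        (Λ * κ x) ^ 2 * ‖w.val x‖ ^ 2) = Λ⁻¹ / 2 * ((κ x)⁻¹ * ‖f x‖ ^ 2) +
        inner ℝ (f x) (w.val x) + Λ / 2 * (κ x * ‖w.val x‖ ^ 2) := by
      field_simp
    rw [h2] at h1
    simp only [real_inner_self_eq_norm_sq]
    linarith
  linarith

end CEM

end

theorem theorem1 {d : ℕ} (hd : d = 2 ∨ d = 3)
    {ι τ : Type*} [Fintype ι] [Nonempty ι] [DecidableEq ι] [Fintype τ]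
    -- domain, boundary parts, coefficients and data
    (Ω Γa Γb : Set (CEM.Pt d)) (hΩ : CEM.IsLipschitzDomain Ω)
    (hΓa : MeasurableSet Γa) (hΓb : MeasurableSet Γb) (hΓ : frontier Ω = Γa ∪ Γb)
    (lam mu : CEM.Pt d → ℝ) (hLame : CEM.IsLame Ω lam mu)
    (f g : CEM.Pt d → CEM.Pt d) (h : CEM.VF d)
    (hf : MeasureTheory.MemLp f 2 (CEM.vol Ω)) (hg : MeasureTheory.MemLp g 2 (CEM.surf Γb))
    (hh : CEM.IsH1 Ω Ω h)
    -- the solution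
    (u : CEM.VF d) (hu : CEM.IsWeakSolution Ω Γa Γb lam mu f g h (u - h))
    -- coarse grid and weight
    (K : ι → Set (CEM.Pt d)) (hK : CEM.IsCoarseGrid Ω K)
    (χ : τ → CEM.Pt d → ℝ) (hχ : CEM.IsPartitionOfUnity Ω χ)
    (hκ : ∃ c > 0, ∀ᵐ x ∂(CEM.vol Ω), c ≤ CEM.kappa lam mu χ x)
    -- snapshot spaces, local eigenpairs, numbers of auxiliary functions
    (V : ι → Submodule ℝ (CEM.VF d))
    (hV : ∀ j v, v ∈ V j → CEM.IsH1 Ω (K j) v) (hV' : ∀ j v, CEM.IsH1a Ω Γa (K j) v → v ∈ V j)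
    (θ : ι → ℕ → ℝ) (φ : ι → ℕ → CEM.VF d)
    (hφ : ∀ j, CEM.IsEigenSystem lam mu (CEM.kappa lam mu χ) (K j) (V j) (θ j) (φ j))
    (n : ι → ℕ)
    -- global constrained basis functions
    (ξ : ι → ℕ → CEM.VF d)
    (hξ : ∀ j, ∀ i < n j, CEM.IsGlobalBasis Ω Γa lam mu (CEM.kappa lam mu χ) K
      (CEM.auxSpace φ n) (Pi.single j (φ j i)) (ξ j i))
    -- global correctors and global multiscale solution
    (Hh Gg : ι → CEM.VF d) (l : CEM.VF d)
    (hHh : ∀ j, CEM.IsGlobalCorrector Ω Γa lam mu (CEM.kappa lam mu χ) K (CEM.auxSpace φ n)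
      (fun v => CEM.aForm lam mu (K j) h v) j (Hh j))
    (hGg : ∀ j, CEM.IsGlobalCorrector Ω Γa lam mu (CEM.kappa lam mu χ) K (CEM.auxSpace φ n)
      (fun v => CEM.neumannLoad Γb g (K j) v) j (Gg j))
    (hl : CEM.IsGlobalGalerkin Ω Γb lam mu f g h (CEM.gloSpace ξ n) (∑ j, Hh j) (∑ j, Gg j) l)
    -- the numerical solution and the smallest first-excluded eigenvalue
    (uglo : CEM.VF d) (huglo : uglo = l - ∑ j, Hh j + ∑ j, Gg j + h)
    (Λ : ℝ) (hΛ : Λ = ⨅ j, θ j (n j)) (hΛpos : 0 < Λ) :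
    CEM.aNorm lam mu Ω (uglo - u) ≤
        Λ ^ (-(1 / 2) : ℝ) * Real.sqrt (∫ x in Ω, (CEM.kappa lam mu χ x)⁻¹ * ‖f x‖ ^ 2) ∧
      ((∀ᵐ x ∂(CEM.vol Ω), 1 ≤ CEM.kappa lam mu χ x) →
        CEM.aNorm lam mu Ω (uglo - u) ≤
          Λ ^ (-(1 / 2) : ℝ) * Real.sqrt (∫ x in Ω, ‖f x‖ ^ 2)) := by
  obtain ⟨c, hc, hκc⟩ := hκ
  set κ := CEM.kappa lam mu χ
  have hκtop : MemLp κ ⊤ (CEM.vol Ω) := CEM.memLp_kappa hΩ.1 hLame hχ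
  have hvol : ∀ j, CEM.vol (K j) ≤ CEM.vol Ω := fun j => Measure.restrict_mono (hK.subset j) le_rfl
  have hκK : ∀ j, MemLp κ ⊤ (CEM.vol (K j)) := fun j => hκtop.mono_measure (hvol j)
  have hκpos : ∀ᵐ x ∂(CEM.vol Ω), 0 < κ x := hκc.mono fun x hx => hc.trans_le hx
  have hΓaΩ : Γa ⊆ frontier Ω := hΓ ▸ Set.subset_union_left
  have hΓbΩ : Γb ⊆ frontier Ω := hΓ ▸ Set.subset_union_right
  have hφL2 : ∀ j i, φ j i ∈ CEM.L2Fields (K j) := fun j i =>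
    (hV j _ ((hφ j).mem i)).mem_L2Fields
  let X := CEM.H1aSpace Ω Γa Ω
  have hX : X ≤ CEM.L2Fields Ω := CEM.H1aSpace_le_L2Fields
  let a := CEM.energyForm hLame hX
  have hglo : CEM.gloSpace ξ n ≤ X := Submodule.span_le.2 (by
    rintro _ ⟨j, i, hi, rfl⟩
    exact (hξ j i hi).mem)
  have hHmem : ∑ j, Hh j ∈ X := Submodule.sum_mem _ fun j _ => (hHh j).mem
  have hGmem : ∑ j, Gg j ∈ X := Submodule.sum_mem _ fun j _ => (hGg j).mem
  -- The error is `l - H + G - (u - h)`; its energy pairing splits accordingly.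
  have he : uglo - u = l - ∑ j, Hh j + ∑ j, Gg j - (u - h) := by rw [huglo]; abel
  have hemem : uglo - u ∈ X := by
    rw [he]
    exact X.sub_mem (X.add_mem (X.sub_mem (hglo hl.mem) hHmem) hGmem) hu.mem
  have hsplit : ∀ w ∈ X, CEM.aForm lam mu Ω (uglo - u) w =
      CEM.aForm lam mu Ω l w - CEM.aForm lam mu Ω (∑ j, Hh j) w +
        CEM.aForm lam mu Ω (∑ j, Gg j) w - CEM.aForm lam mu Ω (u - h) w := by
    intro w hw
    rw [he]
    let l' : X := ⟨l, hglo hl.mem⟩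
    let H' : X := ⟨_, hHmem⟩
    let G' : X := ⟨_, hGmem⟩
    let u' : X := ⟨u - h, hu.mem⟩
    have : a (l' - H' + G' - u') ⟨w, hw⟩ =
        a l' ⟨w, hw⟩ - a H' ⟨w, hw⟩ + a G' ⟨w, hw⟩ - a u' ⟨w, hw⟩ := by
      simp only [map_sub, map_add, LinearMap.sub_apply, LinearMap.add_apply]
    exact this
  have hweak : ∀ w ∈ X, CEM.aForm lam mu Ω (u - h) w =
      (∫ x in Ω, inner ℝ (f x) (w.val x)) + (∫ x, inner ℝ (g x) (w.tr x) ∂(CEM.surf Γb))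
        - CEM.stressGrad lam mu Ω h w := fun w hw => by
    rw [← CEM.stressGrad_eq_aForm]
    exact hu.eq w hw
  -- Galerkin orthogonality.
  have hgal : ∀ j, ∀ i < n j, CEM.aForm lam mu Ω (uglo - u) (ξ j i) = 0 := by
    intro j i hi
    rw [hsplit _ (hξ j i hi).mem, hweak _ (hξ j i hi).mem,
      hl.eq _ (Submodule.subset_span ⟨j, i, hi, rfl⟩)]
    ring
  obtain ⟨w, hw, hw0, hew, hew'⟩ := CEM.exists_zero_moments hLame hκK hK.subset hφL2
    (fun j => (hφ j).ne_zero) (fun j => (hφ j).orth) hξ hemem hgal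
  -- On functions without moments the correctors cancel the boundary data, which leaves `f`.
  have hload : CEM.aForm lam mu Ω (uglo - u) w = -∫ x in Ω, inner ℝ (f x) (w.val x) := by
    have hl0 : CEM.aForm lam mu Ω l w = 0 := by
      have hle : CEM.gloSpace ξ n ≤ (LinearMap.ker (a.flip ⟨w, hw⟩)).map X.subtype :=
        Submodule.span_le.2 (by
          rintro _ ⟨j, i, hi, rfl⟩
          refine ⟨⟨ξ j i, (hξ j i hi).mem⟩, ?_, rfl⟩
          refine (hξ j i hi).orthogonal hLame hκK hK.subset hφL2 (fun j' => ?_) hw hw0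
          by_cases hj : j' = j
          · subst hj
            rw [Pi.single_eq_same]
            exact hφL2 _ i
          · rw [Pi.single_eq_of_ne hj]
            exact Submodule.zero_mem _)
      obtain ⟨l', hl', hll⟩ := hle hl.mem
      rw [← hll]
      exact hl'
    have htr : MemLp w.tr 2 (CEM.surf Γb) := hw.1.2.2.1.mono_measure
      (Measure.restrict_mono (Set.subset_inter hΓbΩ hΓbΩ) le_rfl)
    rw [hsplit w hw, hweak w hw, hl0,
      CEM.aForm_sum_corrector hLame hκK hK.subset hφL2 hHh hw hw0,
      CEM.aForm_sum_corrector hLame hκK hK.subset hφL2 hGg hw hw0,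
      hK.sum_neumannLoad hΩ.1 hΓb hΓbΩ hg htr,
      ← hK.aForm_eq_sum hLame hh.mem_L2Fields hw.1.mem_L2Fields, CEM.stressGrad_eq_aForm]
    ring
  have hgap : Λ * CEM.sBlock κ Ω w w ≤ CEM.aForm lam mu Ω w w := by
    have hwL2 := hw.1.mem_L2Fields
    rw [hK.aForm_eq_sum hLame hwL2 hwL2, CEM.sBlock,
      hK.setIntegral_eq_sum (CEM.integrable_mass hκtop hwL2 hwL2), Finset.mul_sum]
    refine Finset.sum_le_sum fun j _ => ?_
    have hκ0 : ∀ᵐ x ∂(CEM.vol (K j)), 0 ≤ κ x := ae_mono (hvol j) (hκpos.mono fun x hx => hx.le)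
    refine (mul_le_mul_of_nonneg_right (b := Λ) (c := θ j (n j)) ?_
      (CEM.sBlock_self_nonneg hκ0 w)).trans ?_
    · rw [hΛ]
      exact ciInf_le (Set.finite_range _).bddBelow j
    · exact (hφ j).le_rayleigh (hLame.mono (hK.subset j)) (hκK j) hκ0
        (fun v hv => (hV j v hv).mem_L2Fields) (n j)
        (hV' j w (hw.restrict hΩ.1 (hK.subset j) hΓaΩ)) (hw0 j)
  have hf2 : Integrable (fun x => ‖f x‖ ^ 2) (CEM.vol Ω) := hf.integrable_norm_pow (by norm_num)
  have hκinv : MemLp (fun x => (κ x)⁻¹) ⊤ (CEM.vol Ω) := by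
    refine memLp_top_of_bound hκtop.1.aemeasurable.inv.aestronglyMeasurable c⁻¹ ?_
    filter_upwards [hκc] with x hx
    rw [norm_inv, Real.norm_of_nonneg (hc.le.trans hx)]
    exact inv_anti₀ hc hx
  have hfκ := CEM.integrable_bdd_mul hκinv hf2
  have hE := CEM.energy_le_of_load hΛpos hκtop hκpos hf hfκ hw.1.mem_L2Fields (hew'.trans hload)
    (hew ▸ hgap)
  have hfirst : CEM.aNorm lam mu Ω (uglo - u) ≤
      Λ ^ (-(1 / 2) : ℝ) * Real.sqrt (∫ x in Ω, (κ x)⁻¹ * ‖f x‖ ^ 2) := by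
    rw [Real.rpow_neg hΛpos.le, ← Real.sqrt_eq_rpow, ← Real.sqrt_inv,
      ← Real.sqrt_mul (inv_nonneg.2 hΛpos.le)]
    exact Real.sqrt_le_sqrt hE
  refine ⟨hfirst, fun hκ1 => hfirst.trans ?_⟩
  refine mul_le_mul_of_nonneg_left (Real.sqrt_le_sqrt ?_) (Real.rpow_nonneg hΛpos.le _)
  refine integral_mono_ae hfκ hf2 (hκ1.mono fun x hx => ?_)
  exact mul_le_of_le_one_left (sq_nonneg _) (inv_le_one_of_one_le₀ hx)
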